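/- There are $n$ prisoners and $r$ rooms, each room having $s$ two-position switches; a configuration of a room is an element of $\{\mathrm{off},\mathrm{on}\}^s$. A schedule is an infinite sequence of visits (prisoner, room), and it is valid if every prisoner is led into every room infinitely often. A (deterministic) protocol prescribes, for each visit, the configuration in which the visiting prisoner leaves the room and whether he declares; this depends only on the identity of the prisoner, on the sequence of configurations he found on his own earlier visits, and on the configuration in which he now finds the room. A protocol is winning for given starting configurations of the rooms if, under every valid schedule, some prisoner eventually declares, and at the first declaration every prisoner has visited every room. Let $0$ denote the all-off configuration, let $1\neq 0$ be another configuration, and designate one of the prisoners as the leader. Suppose that there is a protocol which is winning when all rooms start in configuration $0$, and in which every non-leader ignores all rooms he is sent to (he leaves their configuration unchanged and does not declare) until he sees a room in a configuration other than $0$ or $1$. Then for every choice of (known) starting configurations of the $r$ rooms, there is a protocol for the same $n$, $r$, $s$ which is winning for these starting configurations. -/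

import Mathlib

namespace PrisonersRooms

/-- A configuration of a room with `s` switches (`true` is on, `false` is off). -/
abbrev Config (s : ℕ) : Type := Fin s → Bool

/-- The configuration in which all switches are off. -/
def allOff (s : ℕ) : Config s := fun _ => false

/-- A deterministic protocol for `n` prisoners and rooms with `s` switches.  What a prisoner does
during a visit depends only on who he is, on the list of configurations which he found on his own
earlier visits (most recent first), and on the configuration in which he finds the room now.
The rooms carry no labels, and there is no clock and no communication between prisoners. -/
structure Protocol (n s : ℕ) where
  /-- the configuration in which the prisoner leaves the room -/
  newConfig : Fin n → List (Config s) → Config s → Config s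
  /-- whether the prisoner declares during this visit -/
  declares : Fin n → List (Config s) → Config s → Bool

/-- The situation between two visits. -/
structure State (n r s : ℕ) where
  /-- the current configuration of each room -/
  rooms : Fin r → Config s
  /-- the configurations that each prisoner has found so far, most recent first -/
  seen : Fin n → List (Config s)

/-- A schedule: the `t`-th visit leads prisoner `(sched t).1` into room `(sched t).2`. -/
abbrev Schedule (n r : ℕ) : Type := ℕ → Fin n × Fin r

/-- A schedule is valid if every prisoner is led into every room infinitely often. -/
def Schedule.Valid {n r : ℕ} (sched : Schedule n r) : Prop :=
  ∀ (p : Fin n) (j : Fin r) (N : ℕ), ∃ t, N ≤ t ∧ sched t = (p, j)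

namespace Protocol

variable {n r s : ℕ}

/-- The effect of one visit, of prisoner `v.1` to room `v.2`. -/
def step (P : Protocol n s) (st : State n r s) (v : Fin n × Fin r) : State n r s where
  rooms := Function.update st.rooms v.2 (P.newConfig v.1 (st.seen v.1) (st.rooms v.2))
  seen := Function.update st.seen v.1 (st.rooms v.2 :: st.seen v.1)

/-- The situation before visit number `t` (visits are numbered from `0`). -/
def run (P : Protocol n s) (start : Fin r → Config s) (sched : Schedule n r) : ℕ → State n r s
  | 0 => ⟨start, fun _ => []⟩
  | t + 1 => P.step (P.run start sched t) (sched t)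

/-- The visiting prisoner declares during visit number `t`. -/
def DeclaresAt (P : Protocol n s) (start : Fin r → Config s) (sched : Schedule n r)
    (t : ℕ) : Prop :=
  P.declares (sched t).1 ((P.run start sched t).seen (sched t).1)
    ((P.run start sched t).rooms (sched t).2) = true

/-- A protocol is winning for the starting configurations `start` if under every valid schedule
some prisoner declares, and when the first declaration is made every prisoner has visited every
room. -/
def IsWinning (P : Protocol n s) (start : Fin r → Config s) : Prop :=
  ∀ sched : Schedule n r, sched.Valid →
    ∃ t, P.DeclaresAt start sched t ∧ (∀ t' < t, ¬ P.DeclaresAt start sched t') ∧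
      ∀ (p : Fin n) (j : Fin r), ∃ t' ≤ t, sched t' = (p, j)

/-- Prisoner `p` ignores all rooms until he sees a configuration outside `A`: as long as all the
configurations he has seen, including the present one, lie in `A`, he leaves the room as it is and
does not declare. -/
def IgnoresUntilOutside (P : Protocol n s) (p : Fin n) (A : Set (Config s)) : Prop :=
  ∀ (past : List (Config s)) (c : Config s), (∀ a ∈ past, a ∈ A) → c ∈ A →
    P.newConfig p past c = c ∧ P.declares p past c = false

end Protocol

end PrisonersRooms

namespace PrisonersRooms

open Finset Classical

/-! Reset all rooms to `allOff`, then run `P`. Call a configuration outside `{allOff s, one}`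
unexpected, and let z be the initial number of off rooms. The leader turns each unexpected
configuration into `one` (their number is known), then makes a fixed number of switches `one` →
`allOff`; each follower makes z + 1 switches `allOff` → `one`. Counting off rooms shows that the
leader's last switch can occur only when all followers have finished and all rooms are off
(`Preparing.of_ready`). Until the leader has removed the unexpected configurations nobody creates
off rooms, so at most z follower switches are possible and no follower exhausts his quota
(`Preparing.step`). A follower cannot tell when the reset ends, and need not: once his quota is
spent, an unexpected configuration can only come from `P`, and he joins `P` then with an empty
history. The result is a run of `P` on the schedule from which the ignored visits of followers who
act later are deleted (`isWinning_reset`). -/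

/-! ### Protocols given by memories that are updated at each visit -/

section Machines

variable {n r s : ℕ} {M : Type}

/-- The memory of prisoner `p` after finding the configurations in a list (most recent first). -/
def memoryAfter (visit : Fin n → M → Config s → Config s × Bool × M) (init : Fin n → M) (p : Fin n)
    (past : List (Config s)) : M :=
  past.foldr (fun c m => (visit p m c).2.2) (init p)

/-- The protocol in which prisoner `p`, with memory `m` and finding configuration `c`, leaves the
room in configuration `(visit p m c).1`, declares according to `(visit p m c).2.1`, and updates his
memory to `(visit p m c).2.2`. -/
def Protocol.ofVisit (visit : Fin n → M → Config s → Config s × Bool × M) (init : Fin n → M) :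
    Protocol n s where
  newConfig p past c := (visit p (memoryAfter visit init p past) c).1
  declares p past c := (visit p (memoryAfter visit init p past) c).2.1

/-- The configurations of the rooms and the memories of the prisoners. -/
structure World (n r s : ℕ) (M : Type) where
  /-- the current configuration of each room -/
  rooms : Fin r → Config s
  /-- the current memory of each prisoner -/
  mem : Fin n → M

namespace World

variable (visit : Fin n → M → Config s → Config s × Bool × M)

/-- What the visitor of a room does. -/
def outcome (w : World n r s M) (v : Fin n × Fin r) : Config s × Bool × M :=
  visit v.1 (w.mem v.1) (w.rooms v.2)

/-- The effect of a visit. -/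
def step (w : World n r s M) (v : Fin n × Fin r) : World n r s M where
  rooms := Function.update w.rooms v.2 (w.outcome visit v).1
  mem := Function.update w.mem v.1 (w.outcome visit v).2.2

/-- The situation before visit number `t`. -/
def run (w : World n r s M) (sched : Schedule n r) : ℕ → World n r s M
  | 0 => w
  | t + 1 => (run w sched t).step visit (sched t)

theorem step_eq_self {w : World n r s M} {v : Fin n × Fin r} {b : Bool}
    (h : w.outcome visit v = (w.rooms v.2, b, w.mem v.1)) : w.step visit v = w := by
  simp [step, h]

end World

theorem run_ofVisit (visit : Fin n → M → Config s → Config s × Bool × M) (init : Fin n → M)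
    (start : Fin r → Config s) (sched : Schedule n r) (t : ℕ) :
    ((Protocol.ofVisit visit init).run start sched t).rooms =
        (World.run visit ⟨start, init⟩ sched t).rooms ∧
      ∀ p, memoryAfter visit init p (((Protocol.ofVisit visit init).run start sched t).seen p) =
        (World.run visit ⟨start, init⟩ sched t).mem p := by
  induction t with
  | zero => exact ⟨rfl, fun p => rfl⟩
  | succ t ih =>
    obtain ⟨h1, h2⟩ := ih
    constructor
    · simp only [Protocol.run, Protocol.step, World.run, World.step, World.outcome, ← h1, ← h2]
      rfl
    · intro p
      simp only [Protocol.run, Protocol.step, World.run, World.step, World.outcome]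
      by_cases hp : p = (sched t).1
      · subst hp
        simp only [Function.update_self, ← h1, ← h2]
        rfl
      · simp only [Function.update_of_ne hp, h2]

theorem declaresAt_ofVisit_iff (visit : Fin n → M → Config s → Config s × Bool × M)
    (init : Fin n → M) (start : Fin r → Config s) (sched : Schedule n r) (t : ℕ) :
    (Protocol.ofVisit visit init).DeclaresAt start sched t ↔
      ((World.run visit ⟨start, init⟩ sched t).outcome visit (sched t)).2.1 = true := by
  obtain ⟨h1, h2⟩ := run_ofVisit visit init start sched t
  simp only [Protocol.DeclaresAt, World.outcome, ← h1, ← h2]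
  rfl

end Machines

/-! ### Counting rooms by configuration -/

/-- The number of rooms whose configuration lies in `B`. -/
noncomputable def roomCount {r s : ℕ} (B : Set (Config s)) (rooms : Fin r → Config s) : ℕ :=
  #{j | rooms j ∈ B}

theorem roomCount_update {r s : ℕ} (rooms : Fin r → Config s) (j : Fin r) (x : Config s)
    (B : Set (Config s)) :
    roomCount B (Function.update rooms j x) + (if rooms j ∈ B then 1 else 0) =
      roomCount B rooms + (if x ∈ B then 1 else 0) := by
  simp only [roomCount, card_filter]
  rw [← add_sum_erase univ _ (mem_univ j),
    ← add_sum_erase univ (fun i => if rooms i ∈ B then 1 else 0) (mem_univ j),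
    sum_congr rfl (g := fun i => if rooms i ∈ B then 1 else 0)
    (fun i hi => by rw [Function.update_of_ne (ne_of_mem_erase hi)])]
  simp only [Function.update_self]
  omega

theorem roomCount_le {r s : ℕ} (B : Set (Config s)) (rooms : Fin r → Config s) :
    roomCount B rooms ≤ r :=
  (card_le_univ _).trans_eq (Fintype.card_fin r)

theorem roomCount_eq_iff {r s : ℕ} {B : Set (Config s)} {rooms : Fin r → Config s} :
    roomCount B rooms = r ↔ ∀ j, rooms j ∈ B := by
  have h : roomCount B rooms = r ↔ #{j | rooms j ∈ B} = #(univ : Finset (Fin r)) := by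
    rw [card_univ, Fintype.card_fin, roomCount]
  rw [h, card_filter_eq_iff]
  simp

theorem roomCount_pos_iff {r s : ℕ} {B : Set (Config s)} {rooms : Fin r → Config s} :
    0 < roomCount B rooms ↔ ∃ j, rooms j ∈ B := by
  simp [roomCount, card_pos, Finset.Nonempty]

theorem sum_update_add {ι α : Type*} [DecidableEq ι] (S : Finset ι) (f : ι → α) (g : α → ℕ)
    {j : ι} (hj : j ∈ S) (x : α) :
    ∑ i ∈ S, g (Function.update f j x i) + g (f j) = ∑ i ∈ S, g (f i) + g x := by
  rw [← add_sum_erase S _ hj, ← add_sum_erase S (fun i => g (f i)) hj,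
    sum_congr rfl (g := fun i => g (f i))
    (fun i hi => by rw [Function.update_of_ne (ne_of_mem_erase hi)])]
  simp only [Function.update_self]
  omega

/-- A prisoner remembers how many rooms he still waits for to leave the set of unexpected
configurations, how many switching operations he still has to do, and a list of configurations
that he presents to the given protocol as those found so far. -/
structure Memory (s : ℕ) where
  /-- the number of rooms with an unexpected configuration still to be found -/
  pending : ℕ
  /-- the number of switching operations still to be done -/
  fuel : ℕ
  /-- the history presented to the given protocol -/
  past : List (Config s)

/-! ### The reset protocol and its preparation phase -/

section Reset

variable {n r s : ℕ} (P : Protocol n s) (leader : Fin n) (one : Config s)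

/-- A visit of the leader: he first moves all unexpected configurations to `one`, then
switches rooms from `one` to `allOff`, and finally follows `P`. -/
noncomputable def leaderVisit (m : Memory s) (c : Config s) : Config s × Bool × Memory s :=
  if 0 < m.pending then
    if c ∈ ({allOff s, one} : Set (Config s)) then (c, false, m)
    else (one, false, { m with pending := m.pending - 1 })
  else if 0 < m.fuel then
    if c = one then (allOff s, false, { m with fuel := m.fuel - 1 }) else (c, false, m)
  else (P.newConfig leader m.past c, P.declares leader m.past c, { m with past := c :: m.past })

/-- A visit of another prisoner: he first switches rooms from `allOff` to `one`, then waits for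
an unexpected configuration, and from then on follows `P`. -/
noncomputable def followerVisit (p : Fin n) (m : Memory s) (c : Config s) :
    Config s × Bool × Memory s :=
  if 0 < m.fuel then
    if c = allOff s then (one, false, { m with fuel := m.fuel - 1 }) else (c, false, m)
  -- Ignored visits are not recorded: some may precede the end of the reset, and the follower cannot
  -- tell which.
  else if m.past = [] ∧ c ∈ ({allOff s, one} : Set (Config s)) then (c, false, m)
  else (P.newConfig p m.past c, P.declares p m.past c, { m with past := c :: m.past })

/-- A visit of prisoner `p`. -/
noncomputable def resetVisit (p : Fin n) : Memory s → Config s → Config s × Bool × Memory s :=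
  if p = leader then leaderVisit P leader one else followerVisit P one p

/-- The initial memories. -/
noncomputable def resetInit (start : Fin r → Config s) (p : Fin n) : Memory s :=
  if p = leader then
    ⟨roomCount ({allOff s, one} : Set (Config s))ᶜ start,
      -- One switch for each room not initially off, plus one to undo each follower switch.
      r - roomCount ({allOff s} : Set (Config s)) start +
        ∑ _q ∈ univ.erase leader, (roomCount ({allOff s} : Set (Config s)) start + 1), []⟩
  else ⟨0, roomCount ({allOff s} : Set (Config s)) start + 1, []⟩

/-- The invariant that holds until the leader starts to follow `P`. -/
structure Preparing (w : World n r s (Memory s)) : Prop where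
  pending_eq : (w.mem leader).pending = roomCount ({allOff s, one} : Set (Config s))ᶜ w.rooms
  fuel_eq : roomCount ({allOff s} : Set (Config s)) w.rooms + (w.mem leader).fuel =
    r + ∑ p ∈ univ.erase leader, (w.mem p).fuel
  -- While unexpected rooms remain, off rooms are never created, and a follower spends fuel only by
  -- removing one; hence strictness persists and no follower runs dry.
  lt_fuel : 0 < (w.mem leader).pending → ∀ p, p ≠ leader →
    roomCount ({allOff s} : Set (Config s)) w.rooms < (w.mem p).fuel
  past_eq : ∀ p, (w.mem p).past = []

/-- The amount of work left before the leader starts to follow `P`. -/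
def workLeft (w : World n r s (Memory s)) : ℕ :=
  (w.mem leader).pending + (w.mem leader).fuel + ∑ p ∈ univ.erase leader, (w.mem p).fuel

/-- The leader has started to follow `P`. -/
def Ready (w : World n r s (Memory s)) : Prop :=
  (w.mem leader).pending = 0 ∧ (w.mem leader).fuel = 0

theorem preparing_init (start : Fin r → Config s) :
    Preparing leader one ⟨start, resetInit leader one start⟩ where
  pending_eq := by simp [resetInit]
  fuel_eq := by
    have h := roomCount_le ({allOff s} : Set (Config s)) start
    have h2 : ∑ p ∈ univ.erase leader, (resetInit leader one start p).fuel =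
        ∑ _q ∈ univ.erase leader, (roomCount ({allOff s} : Set (Config s)) start + 1) :=
      sum_congr rfl fun p hp => by simp [resetInit, ne_of_mem_erase hp]
    simp only [h2]
    simp only [resetInit, if_true]
    omega
  lt_fuel _ p hp := by simp [resetInit, hp]
  past_eq p := by simp only [resetInit]; split_ifs <;> rfl

variable {leader one}

theorem Preparing.rooms_mem {w : World n r s (Memory s)} (h : Preparing leader one w)
    (h0 : (w.mem leader).pending = 0) (j : Fin r) :
    w.rooms j ∈ ({allOff s, one} : Set (Config s)) := by
  have h1 := h.pending_eq
  rw [h0] at h1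
  by_contra hj
  exact (roomCount_pos_iff.2 ⟨j, hj⟩).ne h1

/-- At most `r` rooms are off, so with the leader's fuel at 0 the balance `fuel_eq` is tight on both
sides. -/
theorem Preparing.of_ready {w : World n r s (Memory s)} (h : Preparing leader one w)
    (hr : Ready leader w) :
    (∀ j, w.rooms j = allOff s) ∧ ∀ p, p ≠ leader → (w.mem p).fuel = 0 := by
  have h1 := h.fuel_eq
  have h2 := roomCount_le ({allOff s} : Set (Config s)) w.rooms
  rw [hr.2] at h1
  constructor
  · intro j
    exact roomCount_eq_iff.1 (show roomCount {allOff s} w.rooms = r by omega) j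
  · intro p hp
    have h3 : ∑ p ∈ univ.erase leader, (w.mem p).fuel = 0 := by omega
    exact sum_eq_zero_iff.1 h3 p (mem_erase.2 ⟨hp, mem_univ p⟩)

/-- A leader switch trades one unit of fuel for one off room; a follower switch lowers both sides of
`fuel_eq` by one. Every other visit that changes something removes an unexpected configuration
without affecting that balance. -/
theorem Preparing.step {w : World n r s (Memory s)} (hone : one ≠ allOff s)
    (h : Preparing leader one w) (hr : ¬ Ready leader w) (v : Fin n × Fin r) :
    (w.outcome (resetVisit P leader one) v).2.1 = false ∧
    (w.step (resetVisit P leader one) v = w ∨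
      Preparing leader one (w.step (resetVisit P leader one) v) ∧
        workLeft leader (w.step (resetVisit P leader one) v) < workLeft leader w) := by
  obtain ⟨p, j⟩ := v
  have hA := fun x => roomCount_update w.rooms j x ({allOff s, one} : Set (Config s))ᶜ
  have hZ := fun x => roomCount_update w.rooms j x ({allOff s} : Set (Config s))
  obtain ⟨e1, e2, e3, e4⟩ := h
  by_cases hp : p = leader
  · subst hp
    have hs : ∀ m, ∑ q ∈ univ.erase p, (Function.update w.mem p m q).fuel =
        ∑ q ∈ univ.erase p, (w.mem q).fuel := fun m =>
      sum_congr rfl fun q hq => by rw [Function.update_of_ne (ne_of_mem_erase hq)]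
    have ho : w.outcome (resetVisit P p one) (p, j) =
        leaderVisit P p one (w.mem p) (w.rooms j) := by simp [World.outcome, resetVisit]
    by_cases h0 : 0 < (w.mem p).pending
    · by_cases hc : w.rooms j ∈ ({allOff s, one} : Set (Config s))
      · have ho' : w.outcome (resetVisit P p one) (p, j) = (w.rooms j, false, w.mem p) := by
          rw [ho, leaderVisit, if_pos h0, if_pos hc]
        exact ⟨by rw [ho'], Or.inl (World.step_eq_self _ ho')⟩
      · have ho' : w.outcome (resetVisit P p one) (p, j) =
            (one, false, { w.mem p with pending := (w.mem p).pending - 1 }) := by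
          rw [ho, leaderVisit, if_pos h0, if_neg hc]
        refine ⟨by rw [ho'], Or.inr ?_⟩
        have hA1 := hA one
        have hZ1 := hZ one
        have hc0 : w.rooms j ≠ allOff s := fun hh => hc (by simp [hh])
        rw [if_pos (by exact hc), if_neg fun hh => hh (by simp)] at hA1
        rw [if_neg (by simpa using hc0), if_neg (by simpa using hone)] at hZ1
        refine ⟨⟨?_, ?_, ?_, ?_⟩, ?_⟩
        · simp only [World.step, ho', Function.update_self]; omega
        · simp only [World.step, ho', Function.update_self, hs]; omega
        · intro _ q hq
          have := e3 h0 q hq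
          simp only [World.step, ho', Function.update_of_ne hq]; omega
        · intro q
          by_cases hq : q = p
          · subst hq; simp [World.step, ho', e4]
          · simp [World.step, Function.update_of_ne hq, e4]
        · simp only [workLeft, World.step, ho', Function.update_self, hs]; omega
    · have h0' : 0 < (w.mem p).fuel := by
        by_contra hh; exact hr ⟨by omega, by omega⟩
      by_cases hc : w.rooms j = one
      · have ho' : w.outcome (resetVisit P p one) (p, j) =
            (allOff s, false, { w.mem p with fuel := (w.mem p).fuel - 1 }) := by
          rw [ho, leaderVisit, if_neg h0, if_pos h0', if_pos hc]
        refine ⟨by rw [ho'], Or.inr ?_⟩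
        have hA1 := hA (allOff s)
        have hZ1 := hZ (allOff s)
        rw [if_neg fun hh => hh (by simp [hc]), if_neg fun hh => hh (by simp)] at hA1
        rw [if_neg (by simpa [hc] using hone), if_pos (by simp)] at hZ1
        refine ⟨⟨?_, ?_, ?_, ?_⟩, ?_⟩
        · simp only [World.step, ho', Function.update_self]; omega
        · simp only [World.step, ho', Function.update_self, hs]; omega
        · intro hh
          simp only [World.step, ho', Function.update_self] at hh
          exact absurd hh h0
        · intro q
          by_cases hq : q = p
          · subst hq; simp [World.step, ho', e4]
          · simp [World.step, Function.update_of_ne hq, e4]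
        · simp only [workLeft, World.step, ho', Function.update_self, hs]; omega
      · have ho' : w.outcome (resetVisit P p one) (p, j) = (w.rooms j, false, w.mem p) := by
          rw [ho, leaderVisit, if_neg h0, if_pos h0', if_neg hc]
        exact ⟨by rw [ho'], Or.inl (World.step_eq_self _ ho')⟩
  · have hs := fun m : Memory s => sum_update_add (univ.erase leader) w.mem (fun m => m.fuel)
      (mem_erase.2 ⟨hp, mem_univ p⟩) m
    have ho : w.outcome (resetVisit P leader one) (p, j) =
        followerVisit P one p (w.mem p) (w.rooms j) := by simp [World.outcome, resetVisit, hp]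
    by_cases h0 : 0 < (w.mem p).fuel
    · by_cases hc : w.rooms j = allOff s
      · have ho' : w.outcome (resetVisit P leader one) (p, j) =
            (one, false, { w.mem p with fuel := (w.mem p).fuel - 1 }) := by
          rw [ho, followerVisit, if_pos h0, if_pos hc]
        refine ⟨by rw [ho'], Or.inr ?_⟩
        have hA1 := hA one
        have hZ1 := hZ one
        have hs1 := hs { w.mem p with fuel := (w.mem p).fuel - 1 }
        rw [if_neg fun hh => hh (by simp [hc]), if_neg fun hh => hh (by simp)] at hA1
        rw [if_pos (by simp [hc]), if_neg (by simpa using hone)] at hZ1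
        simp only at hs1
        have hl : leader ≠ p := Ne.symm hp
        refine ⟨⟨?_, ?_, ?_, ?_⟩, ?_⟩
        · simp only [World.step, ho', Function.update_of_ne hl]; omega
        · simp only [World.step, ho', Function.update_of_ne hl]; omega
        · intro hh q hq
          simp only [World.step, Function.update_of_ne hl] at hh
          have := e3 hh q hq
          by_cases hqp : q = p
          · subst hqp
            simp only [World.step, ho', Function.update_self]; omega
          · simp only [World.step, ho', Function.update_of_ne hqp]; omega
        · intro q
          by_cases hq : q = p
          · subst hq; simp [World.step, ho', e4]
          · simp [World.step, Function.update_of_ne hq, e4]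
        · simp only [workLeft, World.step, ho', Function.update_of_ne hl]; omega
      · have ho' : w.outcome (resetVisit P leader one) (p, j) = (w.rooms j, false, w.mem p) := by
          rw [ho, followerVisit, if_pos h0, if_neg hc]
        exact ⟨by rw [ho'], Or.inl (World.step_eq_self _ ho')⟩
    -- By `lt_fuel`, a follower without fuel can no longer meet an unexpected room.
    · have hpend : (w.mem leader).pending = 0 := by
        by_contra hh
        have := e3 (by omega) p hp
        omega
      have hc := Preparing.rooms_mem ⟨e1, e2, e3, e4⟩ hpend j
      have ho' : w.outcome (resetVisit P leader one) (p, j) = (w.rooms j, false, w.mem p) := by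
        rw [ho, followerVisit, if_neg h0, if_pos ⟨e4 p, hc⟩]
      exact ⟨by rw [ho'], Or.inl (World.step_eq_self _ ho')⟩

/-- Some visit makes progress. -/
theorem Preparing.exists_step_ne [Nonempty (Fin r)] {w : World n r s (Memory s)}
    (h : Preparing leader one w) (hr : ¬ Ready leader w) :
    ∃ v, w.step (resetVisit P leader one) v ≠ w := by
  by_cases h0 : 0 < (w.mem leader).pending
  · obtain ⟨j, hj'⟩ := roomCount_pos_iff.1 (h.pending_eq ▸ h0)
    replace hj' : w.rooms j ∉ ({allOff s, one} : Set (Config s)) := hj'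
    refine ⟨(leader, j), fun he => ?_⟩
    have := congrArg (fun w => (w.mem leader).pending) he
    simp only [World.step, World.outcome, resetVisit, if_true, leaderVisit, if_pos h0, if_neg hj',
      Function.update_self] at this
    omega
  have h0' : 0 < (w.mem leader).fuel := by
    by_contra hh; exact hr ⟨by omega, by omega⟩
  by_cases h1 : ∃ j, w.rooms j = one
  · obtain ⟨j, hj⟩ := h1
    refine ⟨(leader, j), fun he => ?_⟩
    have := congrArg (fun w => (w.mem leader).fuel) he
    simp only [World.step, World.outcome, resetVisit, if_true, leaderVisit, if_neg h0, if_pos h0',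
      if_pos hj, Function.update_self] at this
    omega
  -- All `r` rooms being off, the balance equates the leader's positive fuel with the followers'
  -- total, so some follower can still switch.
  · have hall : ∀ j, w.rooms j = allOff s := fun j =>
      (h.rooms_mem (by omega) j).resolve_right fun hj => h1 ⟨j, hj⟩
    have h2 := h.fuel_eq
    have h3 : roomCount ({allOff s} : Set (Config s)) w.rooms = r :=
      roomCount_eq_iff.2 hall
    have h4 : ∑ p ∈ univ.erase leader, (w.mem p).fuel ≠ 0 := by omega
    obtain ⟨p, hp, hf⟩ := exists_ne_zero_of_sum_ne_zero h4
    obtain ⟨j⟩ := ‹Nonempty (Fin r)›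
    refine ⟨(p, j), fun he => ?_⟩
    have := congrArg (fun w => (w.mem p).fuel) he
    simp only [World.step, World.outcome, resetVisit, if_neg (ne_of_mem_erase hp), followerVisit,
      if_pos (Nat.pos_of_ne_zero hf), if_pos (hall j), Function.update_self] at this
    omega

/-- The leader eventually starts to follow `P`, and nobody declares before that. -/
theorem exists_ready (hone : one ≠ allOff s) (w : World n r s (Memory s))
    (h : Preparing leader one w) {sched : Schedule n r} (hv : sched.Valid) :
    ∃ T, Preparing leader one (w.run (resetVisit P leader one) sched T) ∧
      Ready leader (w.run (resetVisit P leader one) sched T) ∧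
      ∀ t < T, ((w.run (resetVisit P leader one) sched t).outcome
        (resetVisit P leader one) (sched t)).2.1 = false := by
  set W := w.run (resetVisit P leader one) sched with hW
  have : Nonempty (Fin r) := ⟨(sched 0).2⟩
  have hprep : ∀ t, (∀ t' < t, ¬ Ready leader (W t')) → Preparing leader one (W t) := by
    intro t
    induction t with
    | zero => exact fun _ => h
    | succ t ih =>
      intro ht
      have h1 := ih fun t' h' => ht t' (by omega)
      rcases (h1.step P hone (ht t (by omega)) (sched t)).2 with h2 | h2
      · exact (show W (t + 1) = W t from h2) ▸ h1
      · exact h2.1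
  have hex : ∃ t, Ready leader (W t) := by
    by_contra! hno
    have hprep' : ∀ t, Preparing leader one (W t) := fun t => hprep t fun t' _ => hno t'
    have hstep : ∀ t, W (t + 1) = W t ∨ workLeft leader (W (t + 1)) < workLeft leader (W t) :=
      fun t => ((hprep' t).step P hone (hno t) (sched t)).2.imp id And.right
    -- After a minimum of `workLeft` every visit is idle and the world is frozen, yet validity
    -- eventually supplies a visit that changes it.
    obtain ⟨N, hN⟩ : ∃ N, ∀ t, workLeft leader (W N) ≤ workLeft leader (W t) :=
      ⟨_, fun t => Function.argmin_le (fun t => workLeft leader (W t)) t⟩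
    have hconst : ∀ k, W (N + k) = W N := by
      intro k
      induction k with
      | zero => rfl
      | succ k ih =>
        rcases hstep (N + k) with h1 | h1
        · exact h1.trans ih
        · exact absurd (hN (N + k + 1)) (not_le.2 (ih ▸ h1))
    obtain ⟨v, hne⟩ := (hprep' N).exists_step_ne P (hno N)
    obtain ⟨t, ht, hsv⟩ := hv v.1 v.2 N
    obtain ⟨k, rfl⟩ := Nat.exists_eq_add_of_le ht
    have h1 : W (N + k + 1) = (W (N + k)).step (resetVisit P leader one) (sched (N + k)) := rfl
    rw [hsv, hconst k, show W (N + k + 1) = W N from hconst (k + 1)] at h1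
    exact hne h1.symm
  refine ⟨Nat.find hex, hprep _ fun t ht => Nat.find_min hex ht, Nat.find_spec hex,
    fun t ht => ?_⟩
  exact ((hprep t fun t' h' => Nat.find_min hex (h'.trans ht)).step P hone
    (Nat.find_min hex ht) (sched t)).1

/-! ### Simulating `P` after the reset -/

/-- The situation of the reset protocol agrees with a situation of `P`, in which followers that
wait for an unexpected configuration and will find one later have not visited any room. -/
structure Following (leader : Fin n) (one : Config s) (everActive : Fin n → Prop)
    (w : World n r s (Memory s)) (st : State n r s) : Prop where
  ready : Ready leader w
  fuel_eq : ∀ p, p ≠ leader → (w.mem p).fuel = 0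
  rooms_eq : w.rooms = st.rooms
  leader_eq : (w.mem leader).past = st.seen leader
  active_eq : ∀ p, p ≠ leader → (w.mem p).past ≠ [] → (w.mem p).past = st.seen p
  waiting_mem : ∀ p, p ≠ leader → (w.mem p).past = [] →
    ∀ a ∈ st.seen p, a ∈ ({allOff s, one} : Set (Config s))
  -- `P` is not shown the waiting visits of followers who act later, so that both histories agree
  -- when they wake up.
  waiting_eq : ∀ p, p ≠ leader → (w.mem p).past = [] → everActive p → st.seen p = []

section Following

variable {everActive : Fin n → Prop} {w : World n r s (Memory s)} {st : State n r s}

/-- The visitor is the leader or has found an unexpected configuration, possibly just now. -/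
def Acts (leader : Fin n) (one : Config s) (w : World n r s (Memory s)) (v : Fin n × Fin r) :
    Prop :=
  v.1 = leader ∨ (w.mem v.1).past ≠ [] ∨ w.rooms v.2 ∉ ({allOff s, one} : Set (Config s))

theorem Following.outcome_of_acts (h : Following leader one everActive w st)
    {v : Fin n × Fin r} (hv : Acts leader one w v) :
    w.outcome (resetVisit P leader one) v = (P.newConfig v.1 (w.mem v.1).past (w.rooms v.2),
      P.declares v.1 (w.mem v.1).past (w.rooms v.2),
      { w.mem v.1 with past := w.rooms v.2 :: (w.mem v.1).past }) := by
  by_cases hp : v.1 = leader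
  · simp only [World.outcome, resetVisit, hp, if_true, leaderVisit, h.ready.1, h.ready.2,
      lt_irrefl, if_false]
  · have h1 : ¬ ((w.mem v.1).past = [] ∧ w.rooms v.2 ∈ ({allOff s, one} : Set (Config s))) :=
      fun hh => (hv.resolve_left hp).elim (fun h => h hh.1) fun h => h hh.2
    simp only [World.outcome, resetVisit, if_neg hp, followerVisit, h.fuel_eq _ hp, lt_irrefl,
      if_false, if_neg h1]

theorem Following.outcome_of_not_acts (h : Following leader one everActive w st)
    {v : Fin n × Fin r} (hv : ¬ Acts leader one w v) :
    w.outcome (resetVisit P leader one) v = (w.rooms v.2, false, w.mem v.1) := by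
  simp only [Acts, not_or, not_not] at hv
  simp only [World.outcome, resetVisit, if_neg hv.1, followerVisit, h.fuel_eq _ hv.1, lt_irrefl,
    if_false, if_pos hv.2]

theorem Following.past_eq (h : Following leader one everActive w st)
    {v : Fin n × Fin r} (he : v.1 ≠ leader → everActive v.1) :
    (w.mem v.1).past = st.seen v.1 := by
  by_cases hp : v.1 = leader
  · rw [hp, h.leader_eq]
  · by_cases hn : (w.mem v.1).past = []
    · rw [hn, h.waiting_eq _ hp hn (he hp)]
    · exact h.active_eq _ hp hn

theorem Following.step_of_acts (h : Following leader one everActive w st)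
    {v : Fin n × Fin r} (hv : Acts leader one w v) (he : v.1 ≠ leader → everActive v.1) :
    Following leader one everActive (w.step (resetVisit P leader one) v) (P.step st v) := by
  have ho := h.outcome_of_acts P hv
  have hpast := h.past_eq he
  have hmem : ∀ q, q ≠ v.1 → (w.step (resetVisit P leader one) v).mem q = w.mem q ∧
      (P.step st v).seen q = st.seen q := fun q hq => by
    simp [World.step, Protocol.step, Function.update_of_ne hq]
  have hself : (w.step (resetVisit P leader one) v).mem v.1 =
      { w.mem v.1 with past := w.rooms v.2 :: (w.mem v.1).past } := by
    simp [World.step, ho]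
  have hseen : ((w.step (resetVisit P leader one) v).mem v.1).past = (P.step st v).seen v.1 := by
    rw [hself]
    simp [Protocol.step, ← hpast, h.rooms_eq]
  have hne : ((w.step (resetVisit P leader one) v).mem v.1).past ≠ [] := by simp [hself]
  have hcounters : ∀ q,
      ((w.step (resetVisit P leader one) v).mem q).pending = (w.mem q).pending ∧
        ((w.step (resetVisit P leader one) v).mem q).fuel = (w.mem q).fuel := fun q => by
    by_cases hq : q = v.1
    · rw [hq, hself]; exact ⟨rfl, rfl⟩
    · rw [(hmem _ hq).1]; exact ⟨rfl, rfl⟩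
  refine ⟨?_, ?_, ?_, ?_, ?_, ?_, ?_⟩
  · rw [Ready, (hcounters _).1, (hcounters _).2]; exact h.ready
  · intro p hp
    rw [(hcounters _).2]; exact h.fuel_eq p hp
  · simp only [World.step, ho, Protocol.step, ← hpast, ← h.rooms_eq]
  · by_cases hq : leader = v.1
    · exact hq ▸ hseen
    · rw [(hmem _ hq).1, (hmem _ hq).2]; exact h.leader_eq
  · intro p hp hn
    by_cases hq : p = v.1
    · rw [hq, hseen]
    · rw [(hmem _ hq).1] at hn
      rw [(hmem _ hq).1, (hmem _ hq).2]; exact h.active_eq p hp hn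
  · intro p hp hn
    by_cases hq : p = v.1
    · exact absurd (hq ▸ hn) hne
    · rw [(hmem _ hq).1] at hn
      rw [(hmem _ hq).2]; exact h.waiting_mem p hp hn
  · intro p hp hn
    by_cases hq : p = v.1
    · exact absurd (hq ▸ hn) hne
    · rw [(hmem _ hq).1] at hn
      rw [(hmem _ hq).2]; exact h.waiting_eq p hp hn

theorem Following.step_of_not_acts (h : Following leader one everActive w st)
    {v : Fin n × Fin r} (hv : ¬ Acts leader one w v) :
    w.step (resetVisit P leader one) v = w :=
  World.step_eq_self _ (h.outcome_of_not_acts P hv)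

theorem Following.ignores (h : Following leader one everActive w st)
    (hignore : ∀ p : Fin n, p ≠ leader → P.IgnoresUntilOutside p {allOff s, one})
    {v : Fin n × Fin r} (hv : ¬ Acts leader one w v) :
    P.newConfig v.1 (st.seen v.1) (st.rooms v.2) = st.rooms v.2 ∧
      P.declares v.1 (st.seen v.1) (st.rooms v.2) = false := by
  simp only [Acts, not_or, not_not] at hv
  exact hignore v.1 hv.1 _ _ (h.waiting_mem _ hv.1 hv.2.1) (h.rooms_eq ▸ hv.2.2)

/-- A follower that never acts may be presented to `P` as visiting rooms. -/
theorem Following.step_of_never_active (h : Following leader one everActive w st)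
    (hignore : ∀ p : Fin n, p ≠ leader → P.IgnoresUntilOutside p {allOff s, one})
    {v : Fin n × Fin r} (hv : ¬ Acts leader one w v) (he : ¬ everActive v.1) :
    Following leader one everActive w (P.step st v) := by
  have hnew := (h.ignores P hignore hv).1
  simp only [Acts, not_or, not_not] at hv
  have hseen : ∀ q, q ≠ v.1 → (P.step st v).seen q = st.seen q := fun q hq => by
    simp [Protocol.step, Function.update_of_ne hq]
  refine ⟨h.ready, h.fuel_eq, ?_, ?_, ?_, ?_, ?_⟩
  · simp [Protocol.step, hnew, h.rooms_eq]
  · rw [hseen _ (Ne.symm hv.1)]; exact h.leader_eq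
  · intro p hp hn
    rw [hseen p fun hq => hn (hq ▸ hv.2.1)]; exact h.active_eq p hp hn
  · intro p hp hn
    by_cases hq : p = v.1
    · subst hq
      intro a ha
      simp only [Protocol.step, Function.update_self, List.mem_cons] at ha
      rcases ha with rfl | ha
      · exact h.rooms_eq ▸ hv.2.2
      · exact h.waiting_mem _ hp hn a ha
    · rw [hseen p hq]; exact h.waiting_mem p hp hn
  · intro p hp hn hep
    rw [hseen p fun hq => he (hq ▸ hep)]; exact h.waiting_eq p hp hn hep

theorem Preparing.following (h : Preparing leader one w) (hr : Ready leader w) :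
    Following leader one everActive w ⟨fun _ => allOff s, fun _ => []⟩ where
  ready := hr
  fuel_eq := (h.of_ready hr).2
  rooms_eq := funext (h.of_ready hr).1
  leader_eq := h.past_eq leader
  active_eq p _ hn := absurd (h.past_eq p) hn
  waiting_mem := by simp
  waiting_eq := by simp

end Following

/-- `P` wins on the selected visits. The selection preserves order and the omitted visits carry no
declaration, so the first declaration and the visits preceding it transfer back. -/
theorem isWinning_reset (hone : one ≠ allOff s)
    (hwin : P.IsWinning (fun _ : Fin r => allOff s))
    (hignore : ∀ p : Fin n, p ≠ leader → P.IgnoresUntilOutside p {allOff s, one})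
    (start : Fin r → Config s) :
    (Protocol.ofVisit (resetVisit P leader one) (resetInit leader one start)).IsWinning start := by
  intro sched hv
  simp only [declaresAt_ofVisit_iff]
  obtain ⟨T, hT, hready, hquiet⟩ :=
    exists_ready P hone ⟨start, resetInit leader one start⟩ (preparing_init leader one start) hv
  set W := World.run (resetVisit P leader one) ⟨start, resetInit leader one start⟩ sched with hW
  have hWs : ∀ t, W (t + 1) = (W t).step (resetVisit P leader one) (sched t) := fun t => rfl
  -- This refers to the future, which is harmless: it serves the analysis only and not the protocol.
  let everActive : Fin n → Prop := fun p => ∃ t, T ≤ t ∧ (sched t).1 = p ∧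
    Acts leader one (W t) (sched t)
  -- the visits that are presented to `P`
  let K : ℕ → Prop := fun t => T ≤ t ∧
    (Acts leader one (W t) (sched t) ∨ ¬ everActive (sched t).1)
  have hK : {t | K t}.Infinite := by
    refine Set.infinite_of_not_bddAbove fun ⟨B, hB⟩ => ?_
    obtain ⟨t, ht, hs⟩ := hv leader (sched 0).2 (max T (B + 1))
    have := hB (show K t from ⟨by omega, Or.inl (Or.inl (by rw [hs]))⟩)
    omega
  let sched' : Schedule n r := fun i => sched (Nat.nth K i)
  have hsched' : ∀ t, K t → sched' (Nat.count K t) = sched t := fun t ht => by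
    simp only [sched', Nat.nth_count ht]
  let S := P.run (fun _ => allOff s) sched'
  have hfollow : ∀ t, T ≤ t → Following leader one everActive (W t) (S (Nat.count K t)) := by
    intro t ht
    induction t, ht using Nat.le_induction with
    | base =>
      have h0 : Nat.count K T = 0 := by
        rw [Nat.count_iff_forall_not]
        exact fun t ht hk => absurd hk.1 (not_le.2 ht)
      rw [h0]
      exact hT.following hready
    | succ t ht ih =>
      rw [Nat.count_succ, hWs]
      by_cases ha : Acts leader one (W t) (sched t)
      · have hk : K t := ⟨ht, Or.inl ha⟩
        rw [if_pos hk]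
        simp only [S, Protocol.run, hsched' t hk]
        exact ih.step_of_acts P ha fun _ => ⟨t, ht, rfl, ha⟩
      · rw [ih.step_of_not_acts P ha]
        by_cases he : everActive (sched t).1
        · rw [if_neg fun hk : K t => hk.2.elim ha fun h => h he]
          exact ih
        · have hk : K t := ⟨ht, Or.inr he⟩
          rw [if_pos hk]
          simp only [S, Protocol.run, hsched' t hk]
          exact ih.step_of_never_active P hignore ha he
  have hactive : ∀ p t t', p ≠ leader → T ≤ t → t ≤ t' → ((W t).mem p).past ≠ [] →
      ((W t').mem p).past ≠ [] := by
    intro p t t' hp hTt htt' hn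
    induction t', htt' using Nat.le_induction with
    | base => exact hn
    | succ t' htt' ih =>
      rw [hWs]
      by_cases ha : Acts leader one (W t') (sched t')
      · have ho := (hfollow t' (hTt.trans htt')).outcome_of_acts P ha
        by_cases hq : p = (sched t').1
        · subst hq; simp [World.step, ho]
        · simpa [World.step, Function.update_of_ne hq] using ih
      · rw [(hfollow t' (hTt.trans htt')).step_of_not_acts P ha]
        exact ih
  have hv' : sched'.Valid := by
    intro p j N
    -- Each prisoner loses only finitely many visits: a follower who wakes loses none afterwards,
    -- and one who never wakes loses none from `T` on.
    have key : ∃ B, ∀ t, B ≤ t → sched t = (p, j) → K t := by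
      by_cases hp : p = leader
      · exact ⟨T, fun t ht hs => ⟨ht, Or.inl (Or.inl (by rw [hs, hp]))⟩⟩
      by_cases he : everActive p
      · obtain ⟨t₀, ht₀, hs₀, ha⟩ := he
        refine ⟨t₀ + 1, fun t ht hs => ⟨by omega, Or.inl (Or.inr (Or.inl ?_))⟩⟩
        rw [hs]
        refine hactive p (t₀ + 1) t hp (by omega) ht ?_
        have ho := (hfollow t₀ ht₀).outcome_of_acts P ha
        rw [hWs, ← hs₀]
        simp [World.step, ho]
      · exact ⟨T, fun t ht hs => ⟨ht, Or.inr (by rw [hs]; exact he)⟩⟩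
    obtain ⟨B, hB⟩ := key
    obtain ⟨t, ht, hs⟩ := hv p j (max B (Nat.nth K N))
    have hk := hB t (by omega) hs
    refine ⟨Nat.count K t, ?_, (hsched' t hk).trans hs⟩
    exact (Nat.count_nth_of_infinite hK N).ge.trans
      (Nat.count_monotone K ((le_max_right _ _).trans ht))
  obtain ⟨i, hdecl, hfirst, hvisit⟩ := hwin sched' hv'
  have hact : ∀ t, T ≤ t → Acts leader one (W t) (sched t) →
      (((W t).outcome (resetVisit P leader one) (sched t)).2.1 = true ↔
        P.DeclaresAt (fun _ => allOff s) sched' (Nat.count K t)) := by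
    intro t ht ha
    have hf := hfollow t ht
    rw [hf.outcome_of_acts P ha, Protocol.DeclaresAt, hsched' t ⟨ht, Or.inl ha⟩,
      hf.past_eq fun _ => ⟨t, ht, rfl, ha⟩, hf.rooms_eq]
  have hKi : K (Nat.nth K i) := Nat.nth_mem_of_infinite hK i
  have hci : Nat.count K (Nat.nth K i) = i := Nat.count_nth_of_infinite hK i
  refine ⟨Nat.nth K i, ?_, ?_, ?_⟩
  -- A visit at which `P` declares cannot be an ignored one.
  · have ha : Acts leader one (W (Nat.nth K i)) (sched (Nat.nth K i)) := by
      by_contra ha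
      have h1 := ((hfollow _ hKi.1).ignores P hignore ha).2
      rw [hci] at h1
      exact absurd (h1.symm.trans hdecl) (by simp)
    rw [hact _ hKi.1 ha, hci]
    exact hdecl
  · intro t ht hd
    by_cases hTt : T ≤ t
    · by_cases ha : Acts leader one (W t) (sched t)
      · refine hfirst _ ?_ ((hact t hTt ha).1 hd)
        exact hci ▸ Nat.count_strict_mono (show K t from ⟨hTt, Or.inl ha⟩) ht
      · rw [(hfollow t hTt).outcome_of_not_acts P ha] at hd
        exact absurd hd (by simp)
    · exact absurd ((hquiet t (by omega)).symm.trans hd) (by simp)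
  · intro p j
    obtain ⟨i', hi', hs⟩ := hvisit p j
    exact ⟨Nat.nth K i', Nat.nth_monotone hK hi', hs⟩

end Reset

end PrisonersRooms

theorem mainTheorem4 (n r s : ℕ) (one : PrisonersRooms.Config s)
    (hone : one ≠ PrisonersRooms.allOff s)
    (P : PrisonersRooms.Protocol n s)
    (hwin : P.IsWinning (fun _ : Fin r => PrisonersRooms.allOff s))
    (leader : Fin n)
    (hignore : ∀ p : Fin n, p ≠ leader →
      P.IgnoresUntilOutside p {PrisonersRooms.allOff s, one})
    (start : Fin r → PrisonersRooms.Config s) :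
    ∃ Q : PrisonersRooms.Protocol n s, Q.IsWinning start :=
  ⟨_, PrisonersRooms.isWinning_reset P hone hwin hignore start⟩
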